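/- Consider a finite-state channel with finite input, output and state alphabets $\mathcal X,\mathcal Y,\mathcal S$ and transition kernel $P_{S^+,Y|X,S}$: given everything up to time $t-1$ and the current input $x_t$, the pair $(s_t,y_t)$ is drawn from $P_{S^+,Y|X,S}(\cdot,\cdot\mid x_t,s_{t-1})$. Let $P(y|x,s)=\sum_{s^+}P_{S^+,Y|X,S}(s^+,y|x,s)$. Assume that the channel is unifilar, i.e. there is $f:\mathcal S\times\mathcal X\times\mathcal Y\to\mathcal S$ with $s_t=f(s_{t-1},x_t,y_t)$ almost surely, and strongly connected, i.e. for all $s,s'\in\mathcal S$ there are an integer $T$ and conditional input distributions $\{P_{X_i|S_{i-1}}\}_{i=1}^T$ such that $\sum_{i=1}^T P_{S_i|S_0}(s|s')>0$. For an initial state $s_0\in\mathcal S$ known to the encoder and the decoder, let $\mathrm C^{\mathrm{fb}}(s_0)$ be the feedback capacity, i.e. the supremum of all rates $R\ge 0$ for which there is a sequence of codes with blocklengths $n=0,1,2,\dots$ and $\lceil 2^{nR}\rceil$ equiprobable messages, encoders $x_i=\phi_i(m,y^{i-1})$, $1\le i\le n$, and decoder $\hat m=\psi(y^n)$ (the code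 may depend on $s_0$), whose average error probability tends to $0$ as $n\to\infty$. A $Q$-graph is a finite set $\mathcal Q$ with a map $\Phi:\mathcal Q\times\mathcal Y\to\mathcal Q$ such that the directed graph with an edge from $q$ to $\Phi(q,y)$ for all $q\in\mathcal Q$, $y\in\mathcal Y$ has a directed path from each vertex to each other vertex. An input distribution $P(x|s,q)$ (a probability distribution on $\mathcal X$ for each $(s,q)\in\mathcal S\times\mathcal Q$) induces a Markov chain on $\mathcal S\times\mathcal Q$ with transition kernel $$P(s',q'\mid s,q)=\sum_{y:\,\Phi(q,y)=q'}\ \sum_{x:\,f(s,x,y)=s'}P(x|s,q)\,P(y|x,s).$$ Call $P(x|s,q)$ admissible if this chain has a unique stationary distribution, which is then denoted by $\pi(s,q)$. Theorem. For every $Q$-graph for which at least one admissible input distribution exists, and for every $s_0\in\mathcal S$, $$\mathrm C^{\mathrm{fb}}(s_0)\ \le\ \sup_{P(x|s,q)\ \text{admissible}} I(X,S;Y\mid Q),$$ where $I(X,S;Y|Q)$ is the conditional mutual information (in bits) for the joint distribution $P(s,q,x,y)=\pi(s,q)\,P(x|s,q)\,P(y|x,s)$. -/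

import Mathlib

open Filter Topology

namespace FeedbackChannel

/-- A finite-state channel: the transition kernel `P(s⁺, y | x, s)`, written `kernel s x (s⁺, y)`. -/
structure FSC (S X Y : Type*) [Fintype S] [Fintype Y] where
  kernel : S → X → S × Y → ℝ
  kernel_mem : ∀ s x, kernel s x ∈ stdSimplex ℝ (S × Y)

/-- A feedback code with `M` messages and blocklength `n`. The input number `i` (counted from `0`) is
computed from the message and the outputs with indices `0, …, i - 1`. -/
structure FeedbackCode (X Y : Type*) (n M : ℕ) where
  enc : (i : Fin n) → Fin M → (Fin (i : ℕ) → Y) → X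
  dec : (Fin n → Y) → Fin M

section Operational

variable {S X Y : Type*} [Fintype S] [Fintype X] [Fintype Y]

namespace FSC

/-- The output law `P(y | x, s)`. -/
noncomputable def outputLaw (ch : FSC S X Y) (s : S) (x : X) (y : Y) : ℝ :=
  ∑ s' : S, ch.kernel s x (s', y)

/-- The channel is unifilar with state evolution `s⁺ = f(s, x, y)` (almost surely). -/
def IsUnifilar (ch : FSC S X Y) (f : S → X → Y → S) : Prop :=
  ∀ s x s' y, ch.kernel s x (s', y) ≠ 0 → s' = f s x y

/-- The law of the state after `i` uses of the channel, started in the state `s₀`, when the input of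
use number `i + 1` is drawn from `P i s` if the state before that use is `s`. -/
noncomputable def stateLaw [DecidableEq S] (ch : FSC S X Y) (P : ℕ → S → X → ℝ) (s₀ : S) :
    ℕ → S → ℝ
  | 0 => fun s => if s = s₀ then 1 else 0
  | i + 1 => fun s' =>
      ∑ s : S, ∑ x : X, ∑ y : Y, stateLaw ch P s₀ i s * P i s x * ch.kernel s x (s', y)

/-- Every state can be reached from every state with positive probability, by some finite sequence
of state-dependent input distributions. -/
def StronglyConnected [DecidableEq S] (ch : FSC S X Y) : Prop :=
  ∀ s s₀ : S, ∃ (T : ℕ) (P : ℕ → S → X → ℝ), (∀ i r, P i r ∈ stdSimplex ℝ X) ∧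
    0 < ∑ i ∈ Finset.Icc 1 T, ch.stateLaw P s₀ i s

/-- The probability that, given message `m` and initial state `s₀`, the outputs are `y` and the
states after the channel uses are `s`. -/
noncomputable def pathProb (ch : FSC S X Y) {n M : ℕ} (c : FeedbackCode X Y n M) (s₀ : S)
    (m : Fin M) (y : Fin n → Y) (s : Fin n → S) : ℝ :=
  ∏ i : Fin n,
    ch.kernel ((Fin.cons s₀ s : Fin (n + 1) → S) i.castSucc)
      (c.enc i m (fun j => y ⟨j, j.isLt.trans i.isLt⟩)) (s i, y i)

/-- Average probability of error for a uniformly distributed message. -/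
noncomputable def errorProb (ch : FSC S X Y) {n M : ℕ} (c : FeedbackCode X Y n M) (s₀ : S) : ℝ :=
  (∑ m : Fin M, ∑ y : Fin n → Y, ∑ s : Fin n → S,
    if c.dec y ≠ m then ch.pathProb c s₀ m y s else 0) / (M : ℝ)

/-- The rate `R` (bits per channel use) is achievable with feedback from the initial state `s₀`, by
codes that may depend on `s₀`. -/
def Achievable (ch : FSC S X Y) (s₀ : S) (R : ℝ) : Prop :=
  0 ≤ R ∧ ∃ c : (n : ℕ) → FeedbackCode X Y n ⌈(2 : ℝ) ^ ((n : ℝ) * R)⌉₊,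
    Tendsto (fun n => ch.errorProb (c n) s₀) atTop (𝓝 0)

/-- The feedback capacity: the supremum of all achievable rates. -/
noncomputable def feedbackCapacity (ch : FSC S X Y) (s₀ : S) : EReal :=
  ⨆ (R : ℝ) (_ : ch.Achievable s₀ R), (R : EReal)

end FSC

end Operational

/-- A `Q`-graph with vertex set `Q`: out of each vertex there is exactly one edge with each label
`y`, leading to `next q y`, and the directed graph is irreducible. -/
structure QGraph (Q Y : Type*) where
  next : Q → Y → Q
  irreducible : ∀ u v : Q, Relation.ReflTransGen (fun a b => ∃ y, next a y = b) u v

/-- The conditional mutual information `I(A; B | C)`, in bits, of a probability mass function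
`p (a, b, c)`. -/
noncomputable def condMutualInfo {A B C : Type*} [Fintype A] [Fintype B] [Fintype C]
    (p : A × B × C → ℝ) : ℝ :=
  ∑ a : A, ∑ b : B, ∑ c : C, p (a, b, c) *
    Real.logb 2 (p (a, b, c) * (∑ a' : A, ∑ b' : B, p (a', b', c)) /
      ((∑ b' : B, p (a, b', c)) * (∑ a' : A, p (a', b, c))))

section SingleLetter

variable {S X Y Q : Type*} [Fintype S] [Fintype X] [Fintype Y] [Fintype Q]

/-- An input distribution `P(x | s, q)`. -/
def IsInputDist (P : S → Q → X → ℝ) : Prop :=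
  ∀ s q, P s q ∈ stdSimplex ℝ X

/-- The transition probability `P(s', q' | s, q)` of the chain induced on `S × Q`. -/
noncomputable def transition [DecidableEq S] [DecidableEq Q] (ch : FSC S X Y) (f : S → X → Y → S)
    (G : QGraph Q Y) (P : S → Q → X → ℝ) (s : S) (q : Q) (s' : S) (q' : Q) : ℝ :=
  ∑ x : X, ∑ y : Y,
    if G.next q y = q' ∧ f s x y = s' then P s q x * ch.outputLaw s x y else 0

/-- `π` is a stationary distribution of the chain induced on `S × Q`. -/
def IsStationary [DecidableEq S] [DecidableEq Q] (ch : FSC S X Y) (f : S → X → Y → S)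
    (G : QGraph Q Y) (P : S → Q → X → ℝ) (π : S × Q → ℝ) : Prop :=
  π ∈ stdSimplex ℝ (S × Q) ∧
    ∀ s' q', π (s', q') = ∑ s : S, ∑ q : Q, π (s, q) * transition ch f G P s q s' q'

/-- `P` is an input distribution whose induced chain has a stationary distribution, namely `π`,
and no other one. -/
def IsAdmissible [DecidableEq S] [DecidableEq Q] (ch : FSC S X Y) (f : S → X → Y → S)
    (G : QGraph Q Y) (P : S → Q → X → ℝ) (π : S × Q → ℝ) : Prop :=
  IsInputDist P ∧ IsStationary ch f G P π ∧ ∀ π', IsStationary ch f G P π' → π' = π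

/-- The law `π(s, q) P(x | s, q) P(y | x, s)`, arranged as the law of `((X, S), Y, Q)`. -/
noncomputable def jointLaw (ch : FSC S X Y) (P : S → Q → X → ℝ) (π : S × Q → ℝ) :
    (X × S) × Y × Q → ℝ :=
  fun w => π (w.1.2, w.2.2) * P w.1.2 w.2.2 w.1.1 * ch.outputLaw w.1.2 w.1.1 w.2.1

end SingleLetter

end FeedbackChannel

/-! The converse compares the output law of a code with a reference law in which the next output is
drawn from `w q`, where `q` is the current vertex of the `Q`-graph. Fano's inequality holds relative
to any such reference (`fano_divergence`). Since the vertex is a function of the past outputs, the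
divergence splits by the chain rule into one-step divergences averaged over the laws of (state,
vertex, input) (`divergence_runProb`, `FSC.converse`). Time averages of these laws subconverge to a
law `J` that is stationary for the pair (state, vertex) (`exists_cesaro_limit`). So an achievable
rate is at most the `J`-average of the divergence from `w`, with the same `J` for every allowed `w`.

It remains to make `J` come from an admissible input distribution. Admissibility of one input
distribution gives a pair `c` reachable from all pairs (`IsAdmissible.exists_reachable`), and strong
connectivity places some `(s₀, q₀)` in the class reachable from `c`. The starting vertex belongs to
the analysis only, so `q₀` may be used. Mixing a little of a fully supported stationary law into `J`
gives a strictly positive input distribution, hence an admissible one (`exists_admissible_approx`).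
With `w` the conditional output law of the mixture, the average divergence under the mixture is
exactly the mutual information, and nonnegativity of divergence bounds the share of `J`. Then the
mixing weight tends to zero. -/

namespace FeedbackChannel

/-! ### Stationary laws of finite Markov chains -/

section Markov

/-- Cesàro means of a sequence of probability vectors with `B (ν (k + 1)) = A (ν k)` subconverge to
a probability vector `J` with `B J = A J`. -/
theorem exists_cesaro_limit {E F : Type*} [Fintype E] [Fintype F]
    (A B : (E → ℝ) →ₗ[ℝ] (F → ℝ)) (ν : ℕ → ℕ → E → ℝ) (hν : ∀ n k, ν n k ∈ stdSimplex ℝ E)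
    (h : ∀ n k, B (ν n (k + 1)) = A (ν n k)) :
    ∃ J ∈ stdSimplex ℝ E, ∃ φ : ℕ → ℕ, StrictMono φ ∧
      Tendsto (fun n => ((φ n : ℝ) + 1)⁻¹ • ∑ k ∈ Finset.range (φ n + 1), ν (φ n) k) atTop (𝓝 J) ∧
      B J = A J := by
  set avg : ℕ → E → ℝ := fun n => ((n : ℝ) + 1)⁻¹ • ∑ k ∈ Finset.range (n + 1), ν n k with havg
  have hA : Continuous A := A.continuous_of_finiteDimensional
  have hB : Continuous B := B.continuous_of_finiteDimensional
  have hmem : ∀ n, avg n ∈ stdSimplex ℝ E := by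
    intro n
    have hn : (0 : ℝ) < (n : ℝ) + 1 := by positivity
    rw [havg]
    simp only [Finset.smul_sum]
    refine (convex_stdSimplex ℝ E).sum_mem (fun _ _ => by positivity) ?_ (fun k _ => hν n k)
    simp only [Finset.sum_const, Finset.card_range, nsmul_eq_mul]
    push_cast
    field_simp
  obtain ⟨J, hJ, φ, hφ, hlim⟩ := (isCompact_stdSimplex ℝ E).tendsto_subseq hmem
  refine ⟨J, hJ, φ, hφ, hlim, ?_⟩
  obtain ⟨K₁, hK₁⟩ := ((isCompact_stdSimplex ℝ E).image hA).isBounded.exists_norm_le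
  obtain ⟨K₂, hK₂⟩ := ((isCompact_stdSimplex ℝ E).image hB).isBounded.exists_norm_le
  -- The sum telescopes: only the two boundary terms survive, and they are bounded uniformly in `n`
  -- by compactness of the simplex.
  have hdiff : ∀ n, B (avg n) - A (avg n) = ((n : ℝ) + 1)⁻¹ • (B (ν n 0) - A (ν n n)) := by
    intro n
    simp only [havg, map_smul, map_sum, ← smul_sub]
    rw [Finset.sum_range_succ' (fun k => B (ν n k)), Finset.sum_range_succ (fun k => A (ν n k))]
    simp only [h]
    congr 1
    abel
  have hzero : Tendsto (fun n => B (avg n) - A (avg n)) atTop (𝓝 0) := by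
    refine squeeze_zero_norm (a := fun n : ℕ => (K₂ + K₁) * (1 / ((n : ℝ) + 1))) (fun n => ?_) ?_
    · rw [hdiff, norm_smul, Real.norm_of_nonneg (by positivity), mul_comm, one_div]
      refine mul_le_mul_of_nonneg_right ?_ (by positivity)
      exact (norm_sub_le _ _).trans
        (add_le_add (hK₂ _ ⟨_, hν n 0, rfl⟩) (hK₁ _ ⟨_, hν n n, rfl⟩))
    · simpa using tendsto_one_div_add_atTop_nhds_zero_nat.const_mul (K₂ + K₁)
  have h1 : Tendsto (fun n => B (avg (φ n)) - A (avg (φ n))) atTop (𝓝 (B J - A J)) :=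
    ((hB.tendsto J).comp hlim).sub ((hA.tendsto J).comp hlim)
  exact sub_eq_zero.1 (tendsto_nhds_unique h1 (hzero.comp hφ.tendsto_atTop))

variable {V : Type*} [Fintype V]

theorem vecMul_mem_stdSimplex {T : Matrix V V ℝ} (hT : ∀ v, T v ∈ stdSimplex ℝ V) {μ : V → ℝ}
    (hμ : μ ∈ stdSimplex ℝ V) : Matrix.vecMul μ T ∈ stdSimplex ℝ V := by
  refine ⟨fun v => Finset.sum_nonneg fun u _ => mul_nonneg (hμ.1 u) ((hT u).1 v), ?_⟩
  simp only [Matrix.vecMul, dotProduct]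
  rw [Finset.sum_comm]
  simp only [← Finset.mul_sum, (hT _).2, mul_one, hμ.2]

/-- A stochastic matrix has a stationary distribution on every nonempty closed set of states. -/
theorem exists_stationary_of_closed {T : Matrix V V ℝ} (hT : ∀ v, T v ∈ stdSimplex ℝ V)
    {C : Set V} (hC : ∀ u ∈ C, ∀ v, T u v ≠ 0 → v ∈ C) {v₀ : V} (hv₀ : v₀ ∈ C) :
    ∃ π ∈ stdSimplex ℝ V, Matrix.vecMul π T = π ∧ ∀ v, v ∉ C → π v = 0 := by
  classical
  let ν : ℕ → V → ℝ := fun k => (fun μ => Matrix.vecMul μ T)^[k] (Pi.single v₀ 1)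
  have hsucc : ∀ k, ν (k + 1) = Matrix.vecMul (ν k) T := fun k =>
    Function.iterate_succ_apply' _ _ _
  have hν : ∀ k, ν k ∈ stdSimplex ℝ V := by
    intro k
    induction k with
    | zero => exact single_mem_stdSimplex ℝ v₀
    | succ k ih => rw [hsucc]; exact vecMul_mem_stdSimplex hT ih
  have hsupp : ∀ k v, v ∉ C → ν k v = 0 := by
    intro k
    induction k with
    | zero =>
      intro v hv
      exact Pi.single_eq_of_ne (fun h : v = v₀ => hv (h ▸ hv₀)) _
    | succ k ih =>
      intro v hv
      rw [hsucc]
      refine Finset.sum_eq_zero fun u _ => ?_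
      change ν k u * T u v = 0
      by_cases hu : u ∈ C
      · rw [show T u v = 0 from by_contra fun h => hv (hC u hu v h), mul_zero]
      · rw [ih u hu, zero_mul]
  obtain ⟨J, hJ, φ, -, hlim, hstat⟩ := exists_cesaro_limit (Matrix.vecMulLinear T) LinearMap.id
    (fun _ k => ν k) (fun _ k => hν k) (fun _ k => hsucc k)
  refine ⟨J, hJ, hstat.symm, fun v hv => ?_⟩
  refine tendsto_nhds_unique ((continuous_apply v).continuousAt.tendsto.comp hlim) ?_
  refine tendsto_const_nhds.congr fun n => ?_
  simp [Finset.sum_apply, hsupp _ v hv]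

theorem stationary_pos_of_edge {T : Matrix V V ℝ} (hT : ∀ u v, 0 ≤ T u v) {π : V → ℝ}
    (hπ : ∀ v, 0 ≤ π v) (hstat : Matrix.vecMul π T = π) {u v : V} (hu : 0 < π u)
    (huv : 0 < T u v) : 0 < π v := by
  rw [← hstat]
  exact Finset.sum_pos' (fun w _ => mul_nonneg (hπ w) (hT w v))
    ⟨u, Finset.mem_univ u, mul_pos hu huv⟩

theorem stationary_pos_of_reachable {T : Matrix V V ℝ} (hT : ∀ u v, 0 ≤ T u v) {π : V → ℝ}
    (hπ : ∀ v, 0 ≤ π v) (hstat : Matrix.vecMul π T = π) {u v : V} (hu : 0 < π u)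
    (huv : Relation.ReflTransGen (fun a b => 0 < T a b) u v) : 0 < π v := by
  induction huv with
  | refl => exact hu
  | tail _ h ih => exact stationary_pos_of_edge hT hπ hstat ih h

/-- If some state can be reached from every state, the stationary distribution is unique. -/
theorem stationary_unique {T : Matrix V V ℝ} (hT : ∀ v, T v ∈ stdSimplex ℝ V) (c : V)
    (hc : ∀ v, Relation.ReflTransGen (fun a b => 0 < T a b) v c) {π π' : V → ℝ}
    (hπ : π ∈ stdSimplex ℝ V) (hπ' : π' ∈ stdSimplex ℝ V)
    (hs : Matrix.vecMul π T = π) (hs' : Matrix.vecMul π' T = π') : π' = π := by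
  have hT0 : ∀ u v, 0 ≤ T u v := fun u v => (hT u).1 v
  set d : V → ℝ := π' - π with hd
  have hdT : Matrix.vecMul d T = d := by rw [hd, Matrix.sub_vecMul, hs, hs']
  have hdsum : ∑ v, d v = 0 := by
    simp only [hd, Pi.sub_apply, Finset.sum_sub_distrib, hπ.2, hπ'.2, sub_self]
  have hle : ∀ v ∈ Finset.univ, |d v| ≤ Matrix.vecMul |d| T v := by
    intro v _
    conv_lhs => rw [← hdT]
    refine (Finset.abs_sum_le_sum_abs _ _).trans (Finset.sum_le_sum fun u _ => ?_)
    rw [abs_mul, abs_of_nonneg (hT0 u v), Pi.abs_apply]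
  have hsum : ∑ v, |d v| = ∑ v, Matrix.vecMul |d| T v := by
    simp only [Matrix.vecMul, dotProduct]
    rw [Finset.sum_comm]
    simp only [← Finset.mul_sum, (hT _).2, mul_one, Pi.abs_apply]
  -- The pointwise inequality `hle` has equal totals on both sides, so it is an equality everywhere.
  have habs : Matrix.vecMul |d| T = |d| := by
    funext v
    exact ((Finset.sum_eq_sum_iff_of_le hle).1 hsum v (Finset.mem_univ v)).symm
  have hp : Matrix.vecMul (|d| + d) T = |d| + d := by rw [Matrix.add_vecMul, habs, hdT]
  have hm : Matrix.vecMul (|d| - d) T = |d| - d := by rw [Matrix.sub_vecMul, habs, hdT]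
  have hp0 : ∀ v, 0 ≤ (|d| + d) v := fun v => by
    have := neg_abs_le (d v)
    simp only [Pi.add_apply, Pi.abs_apply]
    linarith
  have hm0 : ∀ v, 0 ≤ (|d| - d) v := fun v => by
    have := le_abs_self (d v)
    simp only [Pi.sub_apply, Pi.abs_apply]
    linarith
  by_contra hne
  obtain ⟨u, hu⟩ : ∃ u, d u ≠ 0 := by
    by_contra! hall
    exact hne (sub_eq_zero.1 (funext hall))
  -- A nonzero `d` with total zero takes both signs, so both nonnegative invariant vectors `|d| + d`
  -- and `|d| - d` are nonzero. Each must then be positive at `c`, although one of them vanishes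
  -- there.
  obtain ⟨a, -, ha⟩ := Finset.exists_pos_of_sum_zero_of_exists_nonzero d hdsum
    ⟨u, Finset.mem_univ u, hu⟩
  obtain ⟨b, -, hb⟩ := Finset.exists_pos_of_sum_zero_of_exists_nonzero (fun v => -d v)
    (by simp [hdsum]) ⟨u, Finset.mem_univ u, neg_ne_zero.2 hu⟩
  have hcp : 0 < (|d| + d) c := stationary_pos_of_reachable hT0 hp0 hp
    (u := a) (by simp only [Pi.add_apply, Pi.abs_apply]; positivity) (hc a)
  have hcm : 0 < (|d| - d) c := stationary_pos_of_reachable hT0 hm0 hm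
    (u := b) (by
      have := abs_nonneg (d b)
      simp only [Pi.sub_apply, Pi.abs_apply]; linarith) (hc b)
  simp only [Pi.add_apply, Pi.sub_apply, Pi.abs_apply] at hcp hcm
  rcases abs_choice (d c) with h | h <;> rw [h] at hcp hcm <;> linarith

end Markov

/-! ### Runs of a feedback policy and their occupation laws -/

section Runs

variable {V X Y : Type*}

theorem sum_fin_succ_fun [Fintype Y] {k : ℕ} (F : (Fin (k + 1) → Y) → ℝ) :
    ∑ y, F y = ∑ y : Fin k → Y, ∑ z : Y, F (Fin.snoc (α := fun _ => Y) y z) := by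
  rw [← (Fin.snocEquiv fun _ => Y).sum_comp F, Fintype.sum_prod_type_right]
  rfl

/-- The state reached from `v₀` after the outputs `y`, under the feedback policy `e`. -/
def runState (step : V → X → Y → V) (v₀ : V) (e : ∀ k : ℕ, (Fin k → Y) → X) :
    ∀ k : ℕ, (Fin k → Y) → V
  | 0, _ => v₀
  | k + 1, y =>
      step (runState step v₀ e k (Fin.init y)) (e k (Fin.init y)) (y (Fin.last k))

/-- The probability of the outputs `y` under the feedback policy `e`, if the output law in state `v`
with input `x` is `p v x`. -/
def runProb (p : V → X → Y → ℝ) (step : V → X → Y → V) (v₀ : V)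
    (e : ∀ k : ℕ, (Fin k → Y) → X) : ∀ k : ℕ, (Fin k → Y) → ℝ
  | 0, _ => 1
  | k + 1, y => runProb p step v₀ e k (Fin.init y) *
      p (runState step v₀ e k (Fin.init y)) (e k (Fin.init y)) (y (Fin.last k))

/-- The joint law of the state after `k` outputs and of the next input. -/
noncomputable def occupation [Fintype Y] (p : V → X → Y → ℝ) (step : V → X → Y → V)
    (v₀ : V) (e : ∀ k : ℕ, (Fin k → Y) → X) (k : ℕ) (w : V × X) : ℝ :=
  open Classical in
  ∑ y : Fin k → Y, if (runState step v₀ e k y, e k y) = w then runProb p step v₀ e k y else 0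

variable (p : V → X → Y → ℝ) (step : V → X → Y → V) (v₀ : V) (e : ∀ k : ℕ, (Fin k → Y) → X)

theorem runState_snoc (k : ℕ) (y : Fin k → Y) (z : Y) :
    runState step v₀ e (k + 1) (Fin.snoc (α := fun _ => Y) y z) =
      step (runState step v₀ e k y) (e k y) z := by
  simp only [runState, Fin.init_snoc, Fin.snoc_last]

theorem runProb_snoc (k : ℕ) (y : Fin k → Y) (z : Y) :
    runProb p step v₀ e (k + 1) (Fin.snoc (α := fun _ => Y) y z) =
      runProb p step v₀ e k y * p (runState step v₀ e k y) (e k y) z := by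
  simp only [runProb, Fin.init_snoc, Fin.snoc_last]

variable {p}

theorem runProb_nonneg (hp : ∀ v x y, 0 ≤ p v x y) : ∀ (k : ℕ) (y : Fin k → Y),
    0 ≤ runProb p step v₀ e k y
  | 0, _ => zero_le_one
  | k + 1, _ => mul_nonneg (runProb_nonneg hp k _) (hp _ _ _)

theorem sum_runProb_eq_one [Fintype Y] (hp : ∀ v x, ∑ y, p v x y = 1) (k : ℕ) :
    ∑ y, runProb p step v₀ e k y = 1 := by
  induction k with
  | zero => simp [runProb]
  | succ k ih =>
    rw [sum_fin_succ_fun]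
    simp only [runProb_snoc, ← Finset.mul_sum, hp, mul_one, ih]

/-- Needed for the reference law: a conditional output law is zero at vertices without mass, so it
is only a subprobability. -/
theorem sum_runProb_le_one [Fintype Y] (hp0 : ∀ v x y, 0 ≤ p v x y)
    (hp : ∀ v x, ∑ y, p v x y ≤ 1) (k : ℕ) : ∑ y, runProb p step v₀ e k y ≤ 1 := by
  induction k with
  | zero => simp [runProb]
  | succ k ih =>
    rw [sum_fin_succ_fun]
    simp only [runProb_snoc, ← Finset.mul_sum]
    exact (Finset.sum_le_sum fun y _ =>
      mul_le_of_le_one_right (runProb_nonneg step v₀ e hp0 k y) (hp _ _)).trans ih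

variable {step v₀}

theorem runState_mem {C : Set V} (hp : ∀ v x y, 0 ≤ p v x y) (hv₀ : v₀ ∈ C)
    (hC : ∀ v ∈ C, ∀ x y, 0 < p v x y → step v x y ∈ C) : ∀ (k : ℕ) (y : Fin k → Y),
    runProb p step v₀ e k y ≠ 0 → runState step v₀ e k y ∈ C
  | 0, _, _ => hv₀
  | k + 1, _, h => hC _ (runState_mem hp hv₀ hC k _ (left_ne_zero_of_mul h)) _ _
      ((hp _ _ _).lt_of_ne' (right_ne_zero_of_mul h))

variable (p step v₀)

theorem sum_occupation_mul [Fintype V] [Fintype X] [Fintype Y] (k : ℕ) (g : V × X → ℝ) :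
    ∑ w, occupation p step v₀ e k w * g w =
      ∑ y, runProb p step v₀ e k y * g (runState step v₀ e k y, e k y) := by
  classical
  simp only [occupation, Finset.sum_mul]
  rw [Finset.sum_comm]
  refine Finset.sum_congr rfl fun y _ => ?_
  simp only [ite_mul, zero_mul, Finset.sum_ite_eq, Finset.mem_univ, if_true]

theorem occupation_mem_stdSimplex [Fintype V] [Fintype X] [Fintype Y]
    (hp : ∀ v x, p v x ∈ stdSimplex ℝ Y) (k : ℕ) :
    occupation p step v₀ e k ∈ stdSimplex ℝ (V × X) := by
  refine ⟨fun w => Finset.sum_nonneg fun _ _ => ?_, ?_⟩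
  · split_ifs
    · exact runProb_nonneg step v₀ e (fun v x => (hp v x).1) k _
    · exact le_rfl
  · have := sum_occupation_mul p step v₀ e k fun _ => 1
    simpa only [mul_one, sum_runProb_eq_one step v₀ e (fun v x => (hp v x).2)] using this

/-- The state marginal of a law on states and inputs. -/
def stateMarginal [Fintype X] : (V × X → ℝ) →ₗ[ℝ] (V → ℝ) where
  toFun J v := ∑ x, J (v, x)
  map_add' J K := by ext v; simp [Finset.sum_add_distrib]
  map_smul' c J := by ext v; simp [Finset.mul_sum]

/-- The law of the next state, given a law on states and inputs. -/
noncomputable def nextStateLaw [Fintype V] [Fintype X] [Fintype Y] :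
    (V × X → ℝ) →ₗ[ℝ] (V → ℝ) where
  toFun J v' := open Classical in
    ∑ w : V × X, J w * ∑ y, if step w.1 w.2 y = v' then p w.1 w.2 y else 0
  map_add' J K := by ext v; simp [Finset.sum_add_distrib, add_mul]
  map_smul' c J := by ext v; simp [Finset.mul_sum, mul_assoc]

/-- This is the recursion required by `exists_cesaro_limit`. It controls only the state marginal,
because the next input depends on the whole output history and not on the state alone. -/
theorem stateMarginal_occupation_succ [Fintype V] [Fintype X] [Fintype Y] (k : ℕ) :
    stateMarginal (occupation p step v₀ e (k + 1)) =
      nextStateLaw p step (occupation p step v₀ e k) := by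
  classical
  funext v'
  have h1 : stateMarginal (occupation p step v₀ e (k + 1)) v' =
      ∑ w, occupation p step v₀ e (k + 1) w * if w.1 = v' then 1 else 0 := by
    rw [Fintype.sum_prod_type, Finset.sum_comm]
    simp [stateMarginal]
  rw [h1, sum_occupation_mul, sum_fin_succ_fun]
  change _ = ∑ w : V × X, occupation p step v₀ e k w *
    ∑ y, if step w.1 w.2 y = v' then p w.1 w.2 y else 0
  rw [sum_occupation_mul p step v₀ e k
    fun w => ∑ y, if step w.1 w.2 y = v' then p w.1 w.2 y else 0]
  refine Finset.sum_congr rfl fun y _ => ?_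
  simp only [runProb_snoc, runState_snoc, Finset.mul_sum]
  exact Finset.sum_congr rfl fun z _ => by split_ifs <;> simp

theorem occupation_eq_zero [Fintype Y] {C : Set V} (hp : ∀ v x y, 0 ≤ p v x y) (hv₀ : v₀ ∈ C)
    (hC : ∀ v ∈ C, ∀ x y, 0 < p v x y → step v x y ∈ C) (k : ℕ) {w : V × X} (hw : w.1 ∉ C) :
    occupation p step v₀ e k w = 0 := by
  refine Finset.sum_eq_zero fun y _ => ?_
  split_ifs with h
  · by_contra hne
    exact hw (h ▸ runState_mem e hp hv₀ hC k y hne)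
  · rfl

end Runs

/-! ### Divergence, Fano's inequality and the chain rule -/

section Divergence

/-- Kullback–Leibler divergence (in nats) of two finite families of weights. -/
noncomputable def divergence {Y : Type*} [Fintype Y] (p w : Y → ℝ) : ℝ :=
  ∑ y, p y * Real.log (p y / w y)

/-- A form of `log t ≤ t - 1` at `t = b / a`. Summed over outputs it yields both nonnegativity of
divergence and Fano's inequality. -/
theorem sub_le_mul_log_div {a b : ℝ} (ha : 0 ≤ a) (hb : 0 ≤ b) (hab : a ≠ 0 → 0 < b) :
    a - b ≤ a * Real.log (a / b) := by
  rcases ha.eq_or_lt with rfl | ha'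
  · simpa using hb
  · have hb' := hab ha'.ne'
    have h := Real.log_le_sub_one_of_pos (div_pos hb' ha')
    have h2 : Real.log (b / a) = -Real.log (a / b) := by rw [← Real.log_inv, inv_div]
    rw [h2] at h
    have h3 := mul_le_mul_of_nonneg_left h ha
    have h4 : a * (b / a - 1) = b - a := by field_simp
    linarith

theorem divergence_nonneg {Y : Type*} [Fintype Y] {p w : Y → ℝ} (hp : p ∈ stdSimplex ℝ Y)
    (hw : ∀ y, 0 ≤ w y) (hw1 : ∑ y, w y ≤ 1) (hpw : ∀ y, p y ≠ 0 → 0 < w y) :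
    0 ≤ divergence p w := by
  have h : ∑ y, (p y - w y) ≤ divergence p w :=
    Finset.sum_le_sum fun y _ => sub_le_mul_log_div (hp.1 y) (hw y) (hpw y)
  rw [Finset.sum_sub_distrib, hp.2] at h
  linarith

/-- Fano's inequality, relative to an arbitrary reference output law `W`. -/
theorem fano_divergence {Ω : Type*} [Fintype Ω] {M : ℕ} (hM : 0 < M) (P : Fin M → Ω → ℝ)
    (hP : ∀ m, P m ∈ stdSimplex ℝ Ω) (W : Ω → ℝ) (hW : ∀ y, 0 ≤ W y) (hW1 : ∑ y, W y ≤ 1)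
    (hPW : ∀ m y, P m y ≠ 0 → 0 < W y) (dec : Ω → Fin M) :
    (1 - (∑ m, ∑ y, if dec y ≠ m then P m y else 0) / (M : ℝ)) * Real.log M - Real.log 2 ≤
      (∑ m, divergence (P m) W) / (M : ℝ) := by
  have hM' : (0 : ℝ) < M := by exact_mod_cast hM
  -- The pointwise inequality is used with `b = W y * (M / 2)` on correct decisions and `b = W y /
  -- 2` on errors. Summed over `m` and `y`, the bracket is `M` times the total of `W`, hence at most
  -- `M`, which is the total of the terms `P m y`.
  have key : ∀ m y, P m y * (Real.log M - Real.log 2) -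
      (if dec y ≠ m then P m y else 0) * Real.log M + P m y -
      (W y / 2 + if dec y = m then W y * (M / 2) else 0) ≤ P m y * Real.log (P m y / W y) := by
    intro m y
    have hP0 := (hP m).1 y
    by_cases h : dec y = m
    · have h1 := sub_le_mul_log_div hP0 (b := W y * (M / 2)) (mul_nonneg (hW y) (by positivity))
        (fun hne => mul_pos (hPW m y hne) (by positivity))
      simp only [h, ne_eq, not_true_eq_false, if_false, if_true]
      rcases hP0.eq_or_lt with h0 | h0
      · rw [← h0]
        have := mul_nonneg (hW y) hM'.le
        have := hW y
        nlinarith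
      · have hw := hPW m y h0.ne'
        rw [← div_div, Real.log_div (by positivity) (by positivity),
          Real.log_div hM'.ne' two_ne_zero] at h1
        have := hW y
        linarith
    · have h1 := sub_le_mul_log_div hP0 (b := W y * (1 / 2)) (mul_nonneg (hW y) (by positivity))
        (fun hne => mul_pos (hPW m y hne) (by positivity))
      simp only [h, ne_eq, not_false_eq_true, if_false, if_true]
      rcases hP0.eq_or_lt with h0 | h0
      · rw [← h0]
        have := hW y
        linarith
      · have hw := hPW m y h0.ne'
        rw [← div_div, Real.log_div (by positivity) (by positivity), one_div, Real.log_inv] at h1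
        linarith
  have hsum := Finset.sum_le_sum fun m (_ : m ∈ Finset.univ) =>
    Finset.sum_le_sum fun y (_ : y ∈ Finset.univ) => key m y
  simp only [Finset.sum_sub_distrib, Finset.sum_add_distrib, ← Finset.sum_mul, (hP _).2,
    ← Finset.sum_div, Finset.sum_const, Finset.card_univ, Fintype.card_fin, nsmul_eq_mul] at hsum
  rw [Finset.sum_comm (f := fun m y => if dec y = m then W y * ((M : ℝ) / 2) else 0)] at hsum
  simp only [Finset.sum_ite_eq, Finset.mem_univ, if_true, ← Finset.sum_mul] at hsum
  rw [le_div_iff₀ hM']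
  have : ((1 - (∑ m, ∑ y, if dec y ≠ m then P m y else 0) / (M : ℝ)) * Real.log M - Real.log 2)
      * M = M * (Real.log M - Real.log 2) -
        (∑ m, ∑ y, if dec y ≠ m then P m y else 0) * Real.log M := by
    field_simp
    ring
  rw [this]
  simp only [divergence]
  have := mul_le_mul_of_nonneg_right hW1 hM'.le
  nlinarith

variable {S X Y Q : Type*}

/-- One step of the joint evolution of the channel state and of the vertex of the `Q`-graph. -/
def jointStep (f : S → X → Y → S) (next : Q → Y → Q) (v : S × Q) (x : X) (y : Y) : S × Q :=
  (f v.1 x y, next v.2 y)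

/-- The vertex is driven by the outputs alone, so one reference law, a run with trivial inputs,
serves all messages and policies. -/
theorem runState_snd (f : S → X → Y → S) (next : Q → Y → Q) (v₀ : S × Q)
    (e : ∀ k : ℕ, (Fin k → Y) → X) (k : ℕ) (y : Fin k → Y) :
    (runState (jointStep f next) v₀ e k y).2 =
      runState (fun q (_ : Unit) y => next q y) v₀.2 (fun _ _ => ()) k y := by
  induction k with
  | zero => rfl
  | succ k ih => simp only [runState, jointStep, ih]

theorem reference_runProb_pos (p : S × Q → X → Y → ℝ) (f : S → X → Y → S) (next : Q → Y → Q)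
    {C : Set (S × Q)} (v₀ : S × Q) (hp : ∀ v x y, 0 ≤ p v x y) (hv₀ : v₀ ∈ C)
    (hC : ∀ v ∈ C, ∀ x y, 0 < p v x y → jointStep f next v x y ∈ C) (w : Q → Y → ℝ)
    (hw : ∀ v ∈ C, ∀ x y, p v x y ≠ 0 → 0 < w v.2 y) (e : ∀ k : ℕ, (Fin k → Y) → X) :
    ∀ (k : ℕ) (y : Fin k → Y),
      runProb p (jointStep f next) v₀ e k y ≠ 0 →
      0 < runProb (fun q (_ : Unit) y => w q y) (fun q _ y => next q y) v₀.2 (fun _ _ => ()) k y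
  | 0, _, _ => one_pos
  | k + 1, y, h => by
    have h1 := left_ne_zero_of_mul h
    have hmem := runState_mem e hp hv₀ hC k _ h1
    have h2 := hw _ hmem _ _ (right_ne_zero_of_mul h)
    rw [runState_snd] at h2
    exact mul_pos (reference_runProb_pos p f next v₀ hp hv₀ hC w hw e k _ h1) h2

/-- Chain rule: the divergence of the output law of a feedback policy from a reference law driven by
the `Q`-graph. -/
theorem divergence_runProb [Fintype S] [Fintype X] [Fintype Y] [Fintype Q] (p : S × Q → X → Y → ℝ) (f : S → X → Y → S) (next : Q → Y → Q)
    {C : Set (S × Q)} (v₀ : S × Q) (hp : ∀ v x, p v x ∈ stdSimplex ℝ Y) (hv₀ : v₀ ∈ C)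
    (hC : ∀ v ∈ C, ∀ x y, 0 < p v x y → jointStep f next v x y ∈ C) (w : Q → Y → ℝ)
    (hw : ∀ v ∈ C, ∀ x y, p v x y ≠ 0 → 0 < w v.2 y) (e : ∀ k : ℕ, (Fin k → Y) → X) (n : ℕ) :
    divergence (runProb p (jointStep f next) v₀ e n)
      (runProb (fun q (_ : Unit) y => w q y) (fun q _ y => next q y) v₀.2 (fun _ _ => ()) n) =
    ∑ k ∈ Finset.range n, ∑ u : (S × Q) × X,
      occupation p (jointStep f next) v₀ e k u *
        divergence (p u.1 u.2) (w u.1.2) := by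
  have hp0 : ∀ v x y, 0 ≤ p v x y := fun v x => (hp v x).1
  induction n with
  | zero => simp [divergence, runProb]
  | succ k ih =>
    rw [Finset.sum_range_succ, ← ih,
      sum_occupation_mul _ _ _ _ _ fun u : (S × Q) × X => divergence (p u.1 u.2) (w u.1.2)]
    simp only [divergence]
    rw [sum_fin_succ_fun, ← Finset.sum_add_distrib]
    refine Finset.sum_congr rfl fun y _ => ?_
    simp only [runProb_snoc]
    set r := runProb p (jointStep f next) v₀ e k y with hr
    set W := runProb (fun q (_ : Unit) y => w q y) (fun q _ y => next q y) v₀.2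
      (fun _ _ => ()) k y with hW
    set v := runState (jointStep f next) v₀ e k y with hv
    rw [← runState_snd f next v₀ e k y, ← hv]
    by_cases hr0 : r = 0
    · simp [hr0]
    have hW0 : 0 < W := reference_runProb_pos p f next v₀ hp0 hv₀ hC w hw e k y hr0
    have hvC : v ∈ C := runState_mem e hp0 hv₀ hC k y hr0
    -- The logarithm splits into the past and the new output; summing over `z` turns the past part
    -- into the divergence for `k` outputs.
    have hz : ∀ z, r * p v (e k y) z * Real.log (r * p v (e k y) z / (W * w v.2 z)) =
        r * Real.log (r / W) * p v (e k y) z +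
          r * (p v (e k y) z * Real.log (p v (e k y) z / w v.2 z)) := by
      intro z
      by_cases hz0 : p v (e k y) z = 0
      · simp [hz0]
      · have := hw v hvC _ z hz0
        rw [mul_div_mul_comm, Real.log_mul (div_ne_zero hr0 hW0.ne') (div_ne_zero hz0 this.ne')]
        ring
    simp only [hz, Finset.sum_add_distrib, ← Finset.mul_sum, (hp _ _).2, mul_one]

end Divergence

/-! ### The channel: converse for one code, reachability and admissibility -/

section Channel

variable {S X Y Q : Type*} [Fintype S] [Fintype Y]

namespace FSC

theorem outputLaw_mem_stdSimplex (ch : FSC S X Y) (s : S) (x : X) :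
    ch.outputLaw s x ∈ stdSimplex ℝ Y := by
  refine ⟨fun y => Finset.sum_nonneg fun s' _ => (ch.kernel_mem s x).1 _, ?_⟩
  rw [← (ch.kernel_mem s x).2, Fintype.sum_prod_type_right]
  rfl

theorem outputLaw_pos_of_kernel_ne_zero (ch : FSC S X Y) {s s' : S} {x : X} {y : Y}
    (h : ch.kernel s x (s', y) ≠ 0) : 0 < ch.outputLaw s x y :=
  Finset.sum_pos' (fun _ _ => (ch.kernel_mem s x).1 _)
    ⟨s', Finset.mem_univ _, ((ch.kernel_mem s x).1 _).lt_of_ne' h⟩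

/-- Unifilarity leaves at most one nonzero term, the one at `f s x y`. -/
theorem sum_kernel_mul {ch : FSC S X Y} {f : S → X → Y → S} (hf : ch.IsUnifilar f) (s : S) (x : X)
    (y : Y) (g : S → ℝ) :
    ∑ s', ch.kernel s x (s', y) * g s' = ch.outputLaw s x y * g (f s x y) := by
  rw [outputLaw, Finset.sum_mul]
  refine Finset.sum_congr rfl fun s' _ => ?_
  by_cases h : ch.kernel s x (s', y) = 0
  · simp [h]
  · rw [hf s x s' y h]

/-- The test function `g` of the final state makes the induction work: the last channel use is
absorbed into it. The case `g = 1` gives the output law of a code. -/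
theorem sum_path_mul {ch : FSC S X Y} {f : S → X → Y → S} (hf : ch.IsUnifilar f)
    (next : Q → Y → Q) (v₀ : S × Q) (e : ∀ k : ℕ, (Fin k → Y) → X) (k : ℕ) :
    ∀ (y : Fin k → Y) (g : S → ℝ),
    ∑ s : Fin k → S, (∏ i : Fin k,
      ch.kernel ((Fin.cons v₀.1 s : Fin (k + 1) → S) i.castSucc)
        (e i fun j => y ⟨j, j.isLt.trans i.isLt⟩) (s i, y i)) *
      g ((Fin.cons v₀.1 s : Fin (k + 1) → S) (Fin.last k)) =
    runProb (fun v : S × Q => ch.outputLaw v.1) (jointStep f next) v₀ e k y *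
      g (runState (jointStep f next) v₀ e k y).1 := by
  induction k with
  | zero => intro y g; simp [runProb, runState]
  | succ k ih =>
    intro y g
    rw [sum_fin_succ_fun]
    have h := ih (Fin.init y) fun s => ch.outputLaw s (e k (Fin.init y)) (y (Fin.last k)) *
      g (f s (e k (Fin.init y)) (y (Fin.last k)))
    simp only [runProb, runState, jointStep]
    rw [mul_assoc]
    refine Eq.trans ?_ h
    refine Finset.sum_congr rfl fun s _ => ?_
    rw [← sum_kernel_mul hf, Finset.mul_sum]
    refine Finset.sum_congr rfl fun t _ => ?_
    rw [Fin.prod_univ_castSucc, Fin.cons_snoc_eq_snoc_cons]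
    simp only [Fin.snoc_castSucc, Fin.snoc_last]
    rw [mul_assoc]
    rfl

end FSC

/-- A feedback policy that agrees with the encoder of the code `c` for the message `m`. -/
def FeedbackCode.policy {n M : ℕ} (c : FeedbackCode X Y n M) (x₀ : X) (m : Fin M) (k : ℕ)
    (y : Fin k → Y) : X :=
  if h : k < n then c.enc ⟨k, h⟩ m y else x₀

theorem FSC.sum_pathProb {ch : FSC S X Y} {f : S → X → Y → S} (hf : ch.IsUnifilar f)
    (next : Q → Y → Q) (v₀ : S × Q) {n M : ℕ} (c : FeedbackCode X Y n M) (x₀ : X) (m : Fin M)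
    (y : Fin n → Y) :
    ∑ s, ch.pathProb c v₀.1 m y s =
      runProb (fun v : S × Q => ch.outputLaw v.1) (jointStep f next) v₀ (c.policy x₀ m) n y := by
  have h := sum_path_mul hf next v₀ (c.policy x₀ m) n y fun _ => 1
  simp only [mul_one] at h
  rw [← h]
  refine Finset.sum_congr rfl fun s _ => Finset.prod_congr rfl fun i _ => ?_
  simp only [FeedbackCode.policy, i.isLt, dif_pos]

/-- The converse for a single code: a bound by the divergence from a reference output law driven by
the `Q`-graph. -/
theorem FSC.converse [Fintype X] [Fintype Q] {ch : FSC S X Y} {f : S → X → Y → S}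
    (hf : ch.IsUnifilar f) (next : Q → Y → Q) {C : Set (S × Q)} {v₀ : S × Q} (hv₀ : v₀ ∈ C)
    (hC : ∀ v ∈ C, ∀ x y, 0 < ch.outputLaw v.1 x y → jointStep f next v x y ∈ C)
    (w : Q → Y → ℝ) (hw0 : ∀ q y, 0 ≤ w q y) (hw1 : ∀ q, ∑ y, w q y ≤ 1)
    (hw : ∀ v ∈ C, ∀ x y, ch.outputLaw v.1 x y ≠ 0 → 0 < w v.2 y)
    {n M : ℕ} (hM : 0 < M) (c : FeedbackCode X Y n M) (x₀ : X) :
    (1 - ch.errorProb c v₀.1) * Real.log M - Real.log 2 ≤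
      ∑ k ∈ Finset.range n, ∑ u : (S × Q) × X,
        ((∑ m, occupation (fun v : S × Q => ch.outputLaw v.1) (jointStep f next) v₀
          (c.policy x₀ m) k u) / (M : ℝ)) * divergence (ch.outputLaw u.1.1 u.2) (w u.1.2) := by
  have hp : ∀ (v : S × Q) (x : X), ch.outputLaw v.1 x ∈ stdSimplex ℝ Y :=
    fun v x => ch.outputLaw_mem_stdSimplex v.1 x
  have hp0 : ∀ (v : S × Q) (x : X) y, 0 ≤ ch.outputLaw v.1 x y := fun v x => (hp v x).1
  have h := fano_divergence hM
    (fun m => runProb (fun v : S × Q => ch.outputLaw v.1) (jointStep f next) v₀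
      (c.policy x₀ m) n)
    (fun m => ⟨runProb_nonneg _ _ _ hp0 n,
      sum_runProb_eq_one _ _ _ (fun v x => (hp v x).2) n⟩)
    (runProb (fun q (_ : Unit) y => w q y) (fun q _ y => next q y) v₀.2 (fun _ _ => ()) n)
    (runProb_nonneg _ _ _ (fun q _ => hw0 q) n)
    (sum_runProb_le_one _ _ _ (fun q _ => hw0 q) (fun q _ => hw1 q) n)
    (fun m y hy => reference_runProb_pos _ f next v₀ hp0 hv₀ hC w hw (c.policy x₀ m) n y hy) c.dec
  have herr : ch.errorProb c v₀.1 = (∑ m, ∑ y, if c.dec y ≠ m then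
      runProb (fun v : S × Q => ch.outputLaw v.1) (jointStep f next) v₀
        (c.policy x₀ m) n y else 0) / (M : ℝ) := by
    rw [FSC.errorProb]
    congr 1
    refine Finset.sum_congr rfl fun m _ => Finset.sum_congr rfl fun y _ => ?_
    split_ifs
    · exact sum_pathProb hf next v₀ c x₀ m y
    · exact Finset.sum_const_zero
  rw [herr]
  refine h.trans (le_of_eq ?_)
  -- The one-step divergence depends on the message only through the current pair and input, so
  -- averaging over messages affects the occupation laws alone.
  simp only [divergence_runProb _ f next v₀ hp hv₀ hC w hw]
  rw [Finset.sum_comm, Finset.sum_div]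
  refine Finset.sum_congr rfl fun k _ => ?_
  rw [Finset.sum_comm, Finset.sum_div]
  refine Finset.sum_congr rfl fun u _ => ?_
  rw [← Finset.sum_mul]
  ring

/-- The pairs `(v, v')` such that `v'` can follow `v` for a suitable input and output. -/
def Edge (ch : FSC S X Y) (f : S → X → Y → S) (next : Q → Y → Q) (v v' : S × Q) : Prop :=
  ∃ x y, 0 < ch.outputLaw v.1 x y ∧ jointStep f next v x y = v'

/-- In a strongly connected channel every channel state can be reached from every pair. -/
theorem exists_reachable_pair [Fintype X] [DecidableEq S] {ch : FSC S X Y} {f : S → X → Y → S}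
    (hf : ch.IsUnifilar f) (hconn : ch.StronglyConnected) (next : Q → Y → Q) (c : S × Q) (s₀ : S) :
    ∃ q₀, Relation.ReflTransGen (Edge ch f next) c (s₀, q₀) := by
  -- In `StronglyConnected` the target state comes first.
  obtain ⟨T, P, -, hpos⟩ := hconn s₀ c.1
  obtain ⟨i, -, hi⟩ := Finset.exists_ne_zero_of_sum_ne_zero hpos.ne'
  have key : ∀ (i : ℕ) (s : S), ch.stateLaw P c.1 i s ≠ 0 →
      ∃ q, Relation.ReflTransGen (Edge ch f next) c (s, q) := by
    intro i
    induction i with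
    | zero =>
      intro s hs
      have hs' : s = c.1 := by
        by_contra h
        exact hs (if_neg h)
      exact ⟨c.2, hs' ▸ Relation.ReflTransGen.refl⟩
    | succ i ih =>
      intro s' hs'
      obtain ⟨s, -, hs⟩ := Finset.exists_ne_zero_of_sum_ne_zero hs'
      obtain ⟨x, -, hx⟩ := Finset.exists_ne_zero_of_sum_ne_zero hs
      obtain ⟨y, -, hy⟩ := Finset.exists_ne_zero_of_sum_ne_zero hx
      obtain ⟨q, hq⟩ := ih s (left_ne_zero_of_mul (left_ne_zero_of_mul hy))
      have hk := right_ne_zero_of_mul hy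
      refine ⟨next q y, hq.tail ⟨x, y, ch.outputLaw_pos_of_kernel_ne_zero hk, ?_⟩⟩
      rw [hf s x s' y hk]
      rfl
  exact key i s₀ hi

variable [Fintype X] [Fintype Q] [DecidableEq S] [DecidableEq Q]

/-- The transition matrix of the chain induced on `S × Q`. -/
noncomputable def transitionMatrix (ch : FSC S X Y) (f : S → X → Y → S) (G : QGraph Q Y)
    (P : S → Q → X → ℝ) : Matrix (S × Q) (S × Q) ℝ :=
  fun v v' => transition ch f G P v.1 v.2 v'.1 v'.2

variable {ch : FSC S X Y} {f : S → X → Y → S} {G : QGraph Q Y} {P : S → Q → X → ℝ}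

omit [Fintype Q] in
theorem transitionMatrix_apply (v v' : S × Q) : transitionMatrix ch f G P v v' =
    ∑ x, P v.1 v.2 x * ∑ y, if jointStep f G.next v x y = v' then ch.outputLaw v.1 x y else 0 := by
  rw [transitionMatrix, transition]
  refine Finset.sum_congr rfl fun x _ => ?_
  rw [Finset.mul_sum]
  refine Finset.sum_congr rfl fun y _ => ?_
  simp only [jointStep, Prod.ext_iff, mul_ite, mul_zero, and_comm]

theorem transitionMatrix_mem_stdSimplex (hP : IsInputDist P) (v : S × Q) :
    transitionMatrix ch f G P v ∈ stdSimplex ℝ (S × Q) := by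
  constructor
  · intro v'
    rw [transitionMatrix_apply]
    refine Finset.sum_nonneg fun x _ => mul_nonneg ((hP _ _).1 x) (Finset.sum_nonneg fun y _ => ?_)
    split_ifs
    · exact (ch.outputLaw_mem_stdSimplex _ _).1 y
    · exact le_rfl
  · simp only [transitionMatrix_apply]
    rw [Finset.sum_comm]
    simp only [← Finset.mul_sum]
    rw [← (hP v.1 v.2).2]
    refine Finset.sum_congr rfl fun x _ => ?_
    rw [Finset.sum_comm]
    simp [(ch.outputLaw_mem_stdSimplex _ _).2]

theorem edge_of_transitionMatrix_ne_zero {v v' : S × Q}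
    (h : transitionMatrix ch f G P v v' ≠ 0) : Edge ch f G.next v v' := by
  rw [transitionMatrix_apply] at h
  obtain ⟨x, -, hx⟩ := Finset.exists_ne_zero_of_sum_ne_zero h
  obtain ⟨y, -, hy⟩ := Finset.exists_ne_zero_of_sum_ne_zero (right_ne_zero_of_mul hx)
  rw [ne_eq, ite_eq_right_iff, Classical.not_imp] at hy
  exact ⟨x, y, ((ch.outputLaw_mem_stdSimplex _ _).1 y).lt_of_ne' hy.2, hy.1⟩

/-- For every input distribution the positive transitions are among the edges; full support realises
all of them. -/
theorem transitionMatrix_pos_of_edge (hP : ∀ s q x, 0 < P s q x) {v v' : S × Q}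
    (h : Edge ch f G.next v v') : 0 < transitionMatrix ch f G P v v' := by
  obtain ⟨x, y, hpos, hstep⟩ := h
  rw [transitionMatrix_apply]
  have h0 : ∀ x y, 0 ≤ if jointStep f G.next v x y = v' then ch.outputLaw v.1 x y else 0 := by
    intro x y
    split_ifs
    · exact (ch.outputLaw_mem_stdSimplex _ _).1 y
    · exact le_rfl
  refine Finset.sum_pos' (fun x _ => mul_nonneg (hP _ _ x).le (Finset.sum_nonneg fun y _ => h0 x y))
    ⟨x, Finset.mem_univ _, mul_pos (hP _ _ x) (Finset.sum_pos' (fun y _ => h0 x y)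
      ⟨y, Finset.mem_univ _, ?_⟩)⟩
  rwa [if_pos hstep]

theorem isStationary_iff {π : S × Q → ℝ} : IsStationary ch f G P π ↔
    π ∈ stdSimplex ℝ (S × Q) ∧ Matrix.vecMul π (transitionMatrix ch f G P) = π := by
  refine and_congr_right fun _ => ?_
  rw [funext_iff, Prod.forall]
  refine forall_congr' fun s' => forall_congr' fun q' => ?_
  rw [eq_comm]
  simp only [Matrix.vecMul, dotProduct, Fintype.sum_prod_type, transitionMatrix]

/-- Translates stationarity of a joint law with inputs into stationarity for the chain of its
conditional input distribution. -/
theorem nextStateLaw_eq_vecMul {J : (S × Q) × X → ℝ} {π : S × Q → ℝ}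
    (hJ : ∀ v x, J (v, x) = π v * P v.1 v.2 x) :
    nextStateLaw (fun v : S × Q => ch.outputLaw v.1) (jointStep f G.next) J =
      Matrix.vecMul π (transitionMatrix ch f G P) := by
  funext v'
  change _ = ∑ v, π v * transitionMatrix ch f G P v v'
  simp only [nextStateLaw, LinearMap.coe_mk, AddHom.coe_mk, transitionMatrix_apply,
    Fintype.sum_prod_type (f := fun w : (S × Q) × X => _)]
  refine Finset.sum_congr rfl fun v _ => ?_
  rw [Finset.mul_sum]
  refine Finset.sum_congr rfl fun x _ => ?_
  rw [hJ, mul_assoc]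

/-- If some input distribution is admissible, some pair is reachable from every pair. -/
theorem IsAdmissible.exists_reachable {π : S × Q → ℝ} (h : IsAdmissible ch f G P π) :
    ∃ c, ∀ v, Relation.ReflTransGen (Edge ch f G.next) v c := by
  obtain ⟨hP, hst, huniq⟩ := h
  obtain ⟨c, -, hc⟩ := Finset.exists_ne_zero_of_sum_ne_zero
    (s := Finset.univ) (f := π) (by rw [hst.1.2]; exact one_ne_zero)
  refine ⟨c, fun v => ?_⟩
  -- The closed set reachable from `v` carries a stationary law. By uniqueness it is `π`, which
  -- charges `c`, so `c` lies in that set.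
  obtain ⟨π', hπ', hs', hsupp⟩ := exists_stationary_of_closed
    (T := transitionMatrix ch f G P) (transitionMatrix_mem_stdSimplex hP)
    (C := {u | Relation.ReflTransGen (Edge ch f G.next) v u})
    (fun u hu u' h => Relation.ReflTransGen.tail hu (edge_of_transitionMatrix_ne_zero h))
    Relation.ReflTransGen.refl
  have heq := huniq π' (isStationary_iff.2 ⟨hπ', hs'⟩)
  by_contra hcv
  exact hc (heq ▸ hsupp c hcv)

theorem isAdmissible_of_pos (hP : IsInputDist P) (hpos : ∀ s q x, 0 < P s q x) {c : S × Q}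
    (hc : ∀ v, Relation.ReflTransGen (Edge ch f G.next) v c) {π : S × Q → ℝ}
    (hπ : IsStationary ch f G P π) : IsAdmissible ch f G P π := by
  refine ⟨hP, hπ, fun π' hπ' => ?_⟩
  rw [isStationary_iff] at hπ hπ'
  exact stationary_unique (transitionMatrix_mem_stdSimplex hP) c
    (fun v => Relation.ReflTransGen.mono
      (fun _ _ h => transitionMatrix_pos_of_edge hpos h) _ _ (hc v)) hπ.1 hπ'.1 hπ.2 hπ'.2

/-- The stationary law of the chain with uniform inputs charges exactly the pairs reachable from
`c`. -/
theorem exists_full_stationary [Nonempty X] {c : S × Q}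
    (hc : ∀ v, Relation.ReflTransGen (Edge ch f G.next) v c) :
    ∃ J ∈ stdSimplex ℝ ((S × Q) × X),
      stateMarginal J = nextStateLaw (fun v : S × Q => ch.outputLaw v.1) (jointStep f G.next) J ∧
      (∀ v x, Relation.ReflTransGen (Edge ch f G.next) c v → 0 < J (v, x)) ∧
      ∀ v x, ¬ Relation.ReflTransGen (Edge ch f G.next) c v → J (v, x) = 0 := by
  let U : S → Q → X → ℝ := fun _ _ _ => (Fintype.card X : ℝ)⁻¹
  have hcard : (0 : ℝ) < Fintype.card X := by exact_mod_cast Fintype.card_pos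
  have hU0 : ∀ s q x, 0 < U s q x := fun _ _ _ => inv_pos.2 hcard
  have hU : IsInputDist U := fun s q => ⟨fun x => (hU0 s q x).le, by
    simp [U, Finset.sum_const, hcard.ne']⟩
  obtain ⟨π, hπ, hs, hsupp⟩ := exists_stationary_of_closed
    (T := transitionMatrix ch f G U) (transitionMatrix_mem_stdSimplex hU)
    (C := {u | Relation.ReflTransGen (Edge ch f G.next) c u})
    (fun u hu u' h => Relation.ReflTransGen.tail hu (edge_of_transitionMatrix_ne_zero h))
    Relation.ReflTransGen.refl
  have hmarg : ∀ v, ∑ x, π v * U v.1 v.2 x = π v := fun v => by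
    rw [← Finset.mul_sum, (hU v.1 v.2).2, mul_one]
  refine ⟨fun u => π u.1 * U u.1.1 u.1.2 u.2,
    ⟨fun u => mul_nonneg (hπ.1 _) (hU0 u.1.1 u.1.2 u.2).le, ?_⟩, ?_, fun v x hv => ?_, fun v x hv => ?_⟩
  · rw [Fintype.sum_prod_type]
    simp only [hmarg, hπ.2]
  · rw [nextStateLaw_eq_vecMul (π := π) (P := U) fun v x => rfl, hs]
    exact funext hmarg
  -- Some `b` is charged, and positivity spreads along `b → c → v`.
  · obtain ⟨b, -, hb⟩ := Finset.exists_ne_zero_of_sum_ne_zero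
      (s := Finset.univ) (f := π) (by rw [hπ.2]; exact one_ne_zero)
    refine mul_pos (stationary_pos_of_reachable
      (fun u => (transitionMatrix_mem_stdSimplex hU u).1) hπ.1 hs
      ((hπ.1 b).lt_of_ne' hb) ?_) (hU0 v.1 v.2 x)
    exact Relation.ReflTransGen.mono (fun _ _ h => transitionMatrix_pos_of_edge hU0 h) _ _
      ((hc b).trans hv)
  · simp only [hsupp v hv, zero_mul]

end Channel

/-! ### From stationary joint laws to the single-letter bound -/

section SingleLetterBound

variable {S X Y Q : Type*} [Fintype S] [Fintype X] [Fintype Y] [Fintype Q]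

/-- The conditional output law `P(y | q)` of the joint law. -/
noncomputable def conditionalOutput (ch : FSC S X Y) (P : S → Q → X → ℝ) (π : S × Q → ℝ) (q : Q)
    (y : Y) : ℝ :=
  (∑ a : X × S, jointLaw ch P π (a, y, q)) /
    ∑ a : X × S, ∑ y' : Y, jointLaw ch P π (a, y', q)

variable {ch : FSC S X Y} {P : S → Q → X → ℝ} {π : S × Q → ℝ}

omit [Fintype X] [Fintype Q] in
theorem jointLaw_nonneg (hP : ∀ s q x, 0 ≤ P s q x) (hπ : ∀ v, 0 ≤ π v) (u : (X × S) × Y × Q) :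
    0 ≤ jointLaw ch P π u :=
  mul_nonneg (mul_nonneg (hπ _) (hP _ _ _)) ((ch.outputLaw_mem_stdSimplex _ _).1 _)

omit [Fintype Q] in
theorem conditionalOutput_nonneg (hP : ∀ s q x, 0 ≤ P s q x) (hπ : ∀ v, 0 ≤ π v) (q : Q) (y : Y) :
    0 ≤ conditionalOutput ch P π q y :=
  div_nonneg (Finset.sum_nonneg fun _ _ => jointLaw_nonneg hP hπ _)
    (Finset.sum_nonneg fun _ _ => Finset.sum_nonneg fun _ _ => jointLaw_nonneg hP hπ _)

omit [Fintype Q] in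
-- At a vertex of zero mass the quotient is `0 / 0 = 0`, so equality with one can fail.
theorem sum_conditionalOutput_le_one (q : Q) : ∑ y, conditionalOutput ch P π q y ≤ 1 := by
  simp only [conditionalOutput]
  rw [← Finset.sum_div, Finset.sum_comm]
  exact div_self_le_one _

omit [Fintype Q] in
theorem conditionalOutput_pos (hP : ∀ s q x, 0 ≤ P s q x) (hπ : ∀ v, 0 ≤ π v) {s : S} {q : Q}
    {x : X} {y : Y} (h : 0 < jointLaw ch P π ((x, s), y, q)) :
    0 < conditionalOutput ch P π q y := by
  have h0 := jointLaw_nonneg (ch := ch) hP hπ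
  refine div_pos (Finset.sum_pos' (fun _ _ => h0 _) ⟨(x, s), Finset.mem_univ _, h⟩)
    (Finset.sum_pos' (fun _ _ => Finset.sum_nonneg fun _ _ => h0 _)
      ⟨(x, s), Finset.mem_univ _, Finset.sum_pos' (fun _ _ => h0 _) ⟨y, Finset.mem_univ _, h⟩⟩)

/-- The conditional mutual information as an average divergence from the conditional output law. -/
theorem log_two_mul_condMutualInfo (hP : ∀ s q x, 0 ≤ P s q x) (hπ : ∀ v, 0 ≤ π v) :
    Real.log 2 * condMutualInfo (jointLaw ch P π) =
      ∑ u : (S × Q) × X, π u.1 * P u.1.1 u.1.2 u.2 *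
        divergence (ch.outputLaw u.1.1 u.2) (conditionalOutput ch P π u.1.2) := by
  have h0 := jointLaw_nonneg (ch := ch) hP hπ
  have hlog2 : Real.log 2 ≠ 0 := (Real.log_pos one_lt_two).ne'
  have hterm : ∀ (x : X) (s : S) (y : Y) (q : Q),
      Real.log 2 * (jointLaw ch P π ((x, s), y, q) *
        Real.logb 2 (jointLaw ch P π ((x, s), y, q) *
          (∑ a' : X × S, ∑ b' : Y, jointLaw ch P π (a', b', q)) /
          ((∑ b' : Y, jointLaw ch P π ((x, s), b', q)) *
            (∑ a' : X × S, jointLaw ch P π (a', y, q))))) =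
      π (s, q) * P s q x * (ch.outputLaw s x y *
        Real.log (ch.outputLaw s x y / conditionalOutput ch P π q y)) := by
    intro x s y q
    have hJ : jointLaw ch P π ((x, s), y, q) = π (s, q) * P s q x * ch.outputLaw s x y := rfl
    by_cases hz : jointLaw ch P π ((x, s), y, q) = 0
    · rw [hz, ← mul_assoc (π (s, q) * P s q x), ← hJ, hz]
      simp
    have hpos : 0 < jointLaw ch P π ((x, s), y, q) := (h0 _).lt_of_ne' hz
    have hb : ∑ b' : Y, jointLaw ch P π ((x, s), b', q) = π (s, q) * P s q x := by
      simp only [jointLaw, ← Finset.mul_sum, (ch.outputLaw_mem_stdSimplex _ _).2, mul_one]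
    have hA : 0 < ∑ a' : X × S, jointLaw ch P π (a', y, q) :=
      Finset.sum_pos' (fun _ _ => h0 _) ⟨(x, s), Finset.mem_univ _, hpos⟩
    rw [hb, conditionalOutput, ← mul_assoc (π (s, q) * P s q x), ← hJ, Real.logb]
    have hw : π (s, q) * P s q x ≠ 0 := fun h => hz (by rw [hJ, h, zero_mul])
    -- The weight `π (s, q) * P s q x` cancels, leaving the channel law over the conditional output
    -- law.
    have harg : jointLaw ch P π ((x, s), y, q) *
        (∑ a' : X × S, ∑ b' : Y, jointLaw ch P π (a', b', q)) /
          (π (s, q) * P s q x * (∑ a' : X × S, jointLaw ch P π (a', y, q))) =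
        ch.outputLaw s x y / ((∑ a' : X × S, jointLaw ch P π (a', y, q)) /
          ∑ a' : X × S, ∑ b' : Y, jointLaw ch P π (a', b', q)) := by
      rw [div_div_eq_mul_div, hJ, mul_assoc (π (s, q) * P s q x), mul_div_mul_left _ _ hw]
    rw [harg]
    field_simp
  have hleft : Real.log 2 * condMutualInfo (jointLaw ch P π) =
      ∑ a : X × S, ∑ y, ∑ q, π (a.2, q) * P a.2 q a.1 * (ch.outputLaw a.2 a.1 y *
        Real.log (ch.outputLaw a.2 a.1 y / conditionalOutput ch P π q y)) := by
    rw [condMutualInfo, Finset.mul_sum]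
    refine Finset.sum_congr rfl fun a _ => ?_
    rw [Finset.mul_sum]
    refine Finset.sum_congr rfl fun y _ => ?_
    rw [Finset.mul_sum]
    exact Finset.sum_congr rfl fun q _ => hterm a.1 a.2 y q
  rw [hleft]
  simp only [divergence, Finset.mul_sum, Fintype.sum_prod_type]
  rw [Finset.sum_comm]
  refine Finset.sum_congr rfl fun s _ => ?_
  rw [Finset.sum_comm (s := (Finset.univ : Finset Q))]
  exact Finset.sum_congr rfl fun x _ => Finset.sum_comm

variable [DecidableEq S] [DecidableEq Q] {f : S → X → Y → S} {G : QGraph Q Y}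

/-- Mixing a stationary joint law on the pairs reachable from `c` with the one for uniform inputs
gives an admissible input distribution. -/
theorem exists_admissible_approx [Nonempty X] {c : S × Q}
    (hc : ∀ v, Relation.ReflTransGen (Edge ch f G.next) v c) {J : (S × Q) × X → ℝ}
    (hJ : J ∈ stdSimplex ℝ ((S × Q) × X))
    (hstat : stateMarginal J =
      nextStateLaw (fun v : S × Q => ch.outputLaw v.1) (jointStep f G.next) J)
    (hsupp : ∀ v x, ¬ Relation.ReflTransGen (Edge ch f G.next) c v → J (v, x) = 0)
    {ε : ℝ} (hε : 0 < ε) (hε1 : ε < 1) :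
    ∃ (P : S → Q → X → ℝ) (π : S × Q → ℝ) (w : Q → Y → ℝ), IsAdmissible ch f G P π ∧
      (∀ q y, 0 ≤ w q y) ∧ (∀ q, ∑ y, w q y ≤ 1) ∧
      (∀ v, Relation.ReflTransGen (Edge ch f G.next) c v → ∀ x y,
        ch.outputLaw v.1 x y ≠ 0 → 0 < w v.2 y) ∧
      (1 - ε) * ∑ u : (S × Q) × X, J u * divergence (ch.outputLaw u.1.1 u.2) (w u.1.2) ≤
        Real.log 2 * condMutualInfo (jointLaw ch P π) := by
  classical
  obtain ⟨U, hU, hUstat, hUpos, hUsupp⟩ := exists_full_stationary (ch := ch) (f := f) (G := G) hc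
  set K : (S × Q) × X → ℝ := (1 - ε) • J + ε • U with hK
  have hKmem : K ∈ stdSimplex ℝ ((S × Q) × X) :=
    convex_stdSimplex ℝ _ hJ hU (sub_nonneg.2 hε1.le) hε.le (by ring)
  have hKstat : stateMarginal K =
      nextStateLaw (fun v : S × Q => ch.outputLaw v.1) (jointStep f G.next) K := by
    rw [hK, map_add, map_add, map_smul, map_smul, map_smul, map_smul, hstat, hUstat]
  have hKpos : ∀ v x, Relation.ReflTransGen (Edge ch f G.next) c v → 0 < K (v, x) := by
    intro v x hv
    exact add_pos_of_nonneg_of_pos (mul_nonneg (sub_nonneg.2 hε1.le) (hJ.1 _))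
      (mul_pos hε (hUpos v x hv))
  have hKsupp : ∀ v x, ¬ Relation.ReflTransGen (Edge ch f G.next) c v → K (v, x) = 0 := by
    intro v x hv
    simp [hK, hsupp v x hv, hUsupp v x hv]
  set π : S × Q → ℝ := stateMarginal K
  have hπ : ∀ v, π v = ∑ x, K (v, x) := fun _ => rfl
  have hπpos : ∀ v, Relation.ReflTransGen (Edge ch f G.next) c v → 0 < π v := fun v hv =>
    Finset.sum_pos (fun x _ => hKpos v x hv) Finset.univ_nonempty
  have hcard : (0 : ℝ) < Fintype.card X := by exact_mod_cast Fintype.card_pos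
  -- Off the class of `c` the law `K` vanishes and has no conditional; the uniform choice there
  -- keeps `P` strictly positive everywhere.
  let P : S → Q → X → ℝ := fun s q x =>
    if Relation.ReflTransGen (Edge ch f G.next) c (s, q) then K ((s, q), x) / π (s, q)
    else (Fintype.card X : ℝ)⁻¹
  have hPpos : ∀ s q x, 0 < P s q x := by
    intro s q x
    simp only [P]
    split_ifs with h
    · exact div_pos (hKpos _ x h) (hπpos _ h)
    · exact inv_pos.2 hcard
  have hP : IsInputDist P := by
    refine fun s q => ⟨fun x => (hPpos s q x).le, ?_⟩
    simp only [P]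
    split_ifs with h
    · rw [← Finset.sum_div, ← hπ, div_self (hπpos _ h).ne']
    · simp [hcard.ne']
  have hπP : ∀ v x, K (v, x) = π v * P v.1 v.2 x := by
    intro v x
    simp only [P, Prod.mk.eta]
    split_ifs with h
    · rw [mul_div_cancel₀ _ (hπpos _ h).ne']
    · rw [hKsupp v x h, hπ, Finset.sum_eq_zero fun x _ => hKsupp v x h, zero_mul]
  have hπmem : π ∈ stdSimplex ℝ (S × Q) := by
    refine ⟨fun v => Finset.sum_nonneg fun x _ => hKmem.1 _, ?_⟩
    exact (Fintype.sum_prod_type K).symm.trans hKmem.2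
  have hadm : IsAdmissible ch f G P π :=
    isAdmissible_of_pos hP hPpos hc
      (isStationary_iff.2 ⟨hπmem, by rw [← nextStateLaw_eq_vecMul hπP, ← hKstat]⟩)
  have hP0 : ∀ s q x, 0 ≤ P s q x := fun s q x => (hPpos s q x).le
  have hw : ∀ v, Relation.ReflTransGen (Edge ch f G.next) c v → ∀ x y,
      ch.outputLaw v.1 x y ≠ 0 → 0 < conditionalOutput ch P π v.2 y := by
    intro v hv x y hy
    refine conditionalOutput_pos hP0 hπmem.1 (s := v.1) (x := x) ?_
    exact mul_pos (mul_pos (hπpos v hv) (hPpos _ _ _))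
      (((ch.outputLaw_mem_stdSimplex _ _).1 y).lt_of_ne' hy)
  refine ⟨P, π, conditionalOutput ch P π, hadm, conditionalOutput_nonneg hP0 hπmem.1,
    sum_conditionalOutput_le_one, hw, ?_⟩
  rw [log_two_mul_condMutualInfo hP0 hπmem.1, Finset.mul_sum]
  -- Termwise, `(1 - ε) * J u ≤ K u` and the divergence is nonnegative on the class; off the class
  -- both weights are zero.
  refine Finset.sum_le_sum fun u _ => ?_
  rw [← hπP]
  by_cases hu : Relation.ReflTransGen (Edge ch f G.next) c u.1
  · have hD : 0 ≤ divergence (ch.outputLaw u.1.1 u.2) (conditionalOutput ch P π u.1.2) :=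
      divergence_nonneg (ch.outputLaw_mem_stdSimplex _ _) (conditionalOutput_nonneg hP0 hπmem.1 _)
        (sum_conditionalOutput_le_one _) (hw u.1 hu u.2)
    rw [← mul_assoc]
    refine mul_le_mul_of_nonneg_right ?_ hD
    exact le_add_of_nonneg_right (mul_nonneg hε.le (hU.1 u))
  · rw [hsupp u.1 u.2 hu, hKsupp u.1 u.2 hu]
    simp

omit [DecidableEq S] [DecidableEq Q] in
/-- An achievable rate is bounded by the average divergence, under some stationary joint law on the
pairs reachable from `c`, from every reference output law. -/
theorem FSC.Achievable.exists_stationary (hf : ch.IsUnifilar f) {c : S × Q} {v₀ : S × Q}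
    (hv₀ : Relation.ReflTransGen (Edge ch f G.next) c v₀) [Nonempty X] {R : ℝ}
    (hR : ch.Achievable v₀.1 R) :
    ∃ J ∈ stdSimplex ℝ ((S × Q) × X),
      stateMarginal J = nextStateLaw (fun v : S × Q => ch.outputLaw v.1) (jointStep f G.next) J ∧
      (∀ v x, ¬ Relation.ReflTransGen (Edge ch f G.next) c v → J (v, x) = 0) ∧
      ∀ w : Q → Y → ℝ, (∀ q y, 0 ≤ w q y) → (∀ q, ∑ y, w q y ≤ 1) →
        (∀ v, Relation.ReflTransGen (Edge ch f G.next) c v → ∀ x y,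
          ch.outputLaw v.1 x y ≠ 0 → 0 < w v.2 y) →
        R * Real.log 2 ≤
          ∑ u : (S × Q) × X, J u * divergence (ch.outputLaw u.1.1 u.2) (w u.1.2) := by
  obtain ⟨hR0, code, herr⟩ := hR
  obtain ⟨x₀⟩ := ‹Nonempty X›
  have hp : ∀ (v : S × Q) (x : X), ch.outputLaw v.1 x ∈ stdSimplex ℝ Y :=
    fun v x => ch.outputLaw_mem_stdSimplex v.1 x
  have hC : ∀ v ∈ {v | Relation.ReflTransGen (Edge ch f G.next) c v}, ∀ x y,
      0 < ch.outputLaw v.1 x y →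
        jointStep f G.next v x y ∈ {v | Relation.ReflTransGen (Edge ch f G.next) c v} :=
    fun v hv x y h => Relation.ReflTransGen.tail hv ⟨x, y, h, rfl⟩
  -- Blocklength `n + 1` avoids division by zero and matches the number of terms in the Cesàro mean.
  let M : ℕ → ℕ := fun n => ⌈(2 : ℝ) ^ (((n + 1 : ℕ) : ℝ) * R)⌉₊
  have hM : ∀ n, 0 < M n := fun n => Nat.ceil_pos.2 (by positivity)
  have hM' : ∀ n, (0 : ℝ) < M n := fun n => by exact_mod_cast hM n
  let occ : (n : ℕ) → Fin (M n) → ℕ → (S × Q) × X → ℝ := fun n m k =>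
    occupation (fun v : S × Q => ch.outputLaw v.1) (jointStep f G.next) v₀
      ((code (n + 1)).policy x₀ m) k
  let ν : ℕ → ℕ → (S × Q) × X → ℝ := fun n k => ∑ m, (M n : ℝ)⁻¹ • occ n m k
  have hν : ∀ n k, ν n k ∈ stdSimplex ℝ ((S × Q) × X) := by
    intro n k
    refine (convex_stdSimplex ℝ _).sum_mem (fun _ _ => (inv_pos.2 (hM' n)).le) ?_
      (fun m _ => occupation_mem_stdSimplex _ _ _ _ hp k)
    rw [Finset.sum_const, Finset.card_univ, Fintype.card_fin, nsmul_eq_mul,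
      mul_inv_cancel₀ (hM' n).ne']
  obtain ⟨J, hJ, φ, hφ, hlim, hstat⟩ := exists_cesaro_limit
    (nextStateLaw (fun v : S × Q => ch.outputLaw v.1) (jointStep f G.next)) stateMarginal ν hν
    (fun n k => by
      simp only [ν, occ, map_sum, map_smul, stateMarginal_occupation_succ])
  refine ⟨J, hJ, hstat, fun v x hv => ?_, fun w hw0 hw1 hw => ?_⟩
  · refine tendsto_nhds_unique
      ((continuous_apply (v, x)).continuousAt.tendsto.comp hlim) ?_
    refine tendsto_const_nhds.congr fun n => ?_
    have hz : ∀ k, ν (φ n) k (v, x) = 0 := by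
      intro k
      simp only [ν, occ, Finset.sum_apply, Pi.smul_apply]
      refine Finset.sum_eq_zero fun m _ => ?_
      rw [occupation_eq_zero (C := {v | Relation.ReflTransGen (Edge ch f G.next) c v}) _ _ _ _
        (fun v x => (hp v x).1) hv₀ hC k (w := (v, x)) hv, smul_zero]
    simp [Finset.sum_apply, hz]
  · set D : (S × Q) × X → ℝ := fun u => divergence (ch.outputLaw u.1.1 u.2) (w u.1.2) with hD
    -- The condition makes the factor of `Real.log (M n)` nonnegative; it holds eventually because
    -- the error tends to zero.
    have hbound : ∀ n : ℕ, ch.errorProb (code (n + 1)) v₀.1 ≤ 1 →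
        (1 - ch.errorProb (code (n + 1)) v₀.1) * (R * Real.log 2) -
          Real.log 2 * (1 / ((n : ℝ) + 1)) ≤
        ∑ u, (((n : ℝ) + 1)⁻¹ • ∑ k ∈ Finset.range (n + 1), ν n k) u * D u := by
      intro n he
      have h := FSC.converse hf G.next hv₀ hC w hw0 hw1 hw (hM n) (code (n + 1)) x₀
      have hn : (0 : ℝ) < (n : ℝ) + 1 := by positivity
      have hlogM : ((n : ℝ) + 1) * (R * Real.log 2) ≤ Real.log (M n) := by
        have h1 := Real.log_le_log (by positivity)
          (Nat.le_ceil ((2 : ℝ) ^ (((n + 1 : ℕ) : ℝ) * R)))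
        rw [Real.log_rpow two_pos, mul_assoc] at h1
        exact_mod_cast h1
      have hsum : ∑ u, (((n : ℝ) + 1)⁻¹ • ∑ k ∈ Finset.range (n + 1), ν n k) u * D u =
          (∑ k ∈ Finset.range (n + 1), ∑ u : (S × Q) × X,
            ((∑ m, occ n m k u) / (M n : ℝ)) * D u) / ((n : ℝ) + 1) := by
        rw [Finset.sum_comm (s := Finset.range (n + 1))
          (f := fun k u => ((∑ m, occ n m k u) / (M n : ℝ)) * D u), Finset.sum_div]
        refine Finset.sum_congr rfl fun u _ => ?_
        rw [← Finset.sum_mul]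
        simp only [ν, Pi.smul_apply, Finset.sum_apply, smul_eq_mul, ← Finset.mul_sum,
          ← Finset.sum_div]
        ring
      rw [hsum, le_div_iff₀ hn]
      refine le_trans (le_trans (le_of_eq ?_)
        (sub_le_sub_right (mul_le_mul_of_nonneg_left hlogM (sub_nonneg.2 he)) (Real.log 2))) h
      field_simp
    have herr' : Tendsto (fun n => ch.errorProb (code (φ n + 1)) v₀.1) atTop (𝓝 0) :=
      (herr.comp (tendsto_add_atTop_nat 1)).comp hφ.tendsto_atTop
    have hlhs : Tendsto (fun n : ℕ => (1 - ch.errorProb (code (φ n + 1)) v₀.1) *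
        (R * Real.log 2) - Real.log 2 * (1 / ((φ n : ℝ) + 1))) atTop (𝓝 (R * Real.log 2)) := by
      have h2 := (tendsto_one_div_add_atTop_nhds_zero_nat (𝕜 := ℝ)).comp hφ.tendsto_atTop
      have h3 := ((herr'.const_sub 1).mul_const (R * Real.log 2)).sub (h2.const_mul (Real.log 2))
      simpa using h3
    -- For fixed `w` the right-hand side is a linear function of the averaged law, so it passes to
    -- the limit `J`.
    have hrhs := ((continuous_finsetSum Finset.univ fun u _ =>
      (continuous_apply u).mul (continuous_const (y := D u))).tendsto J).comp hlim
    refine le_of_tendsto_of_tendsto hlhs hrhs ?_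
    filter_upwards [herr'.eventually_le_const one_pos] with n hn using hbound (φ n) hn

end SingleLetterBound
end FeedbackChannel

/-! ### The upper bound on the feedback capacity -/

theorem mainTheorem2 {S X Y Q : Type*} [Fintype S] [Fintype X] [Fintype Y] [Fintype Q]
    [DecidableEq S] [DecidableEq Q]
    (ch : FeedbackChannel.FSC S X Y) (f : S → X → Y → S)
    (hf : ch.IsUnifilar f) (hconn : ch.StronglyConnected)
    (G : FeedbackChannel.QGraph Q Y)
    (hadm : ∃ (P : S → Q → X → ℝ) (π : S × Q → ℝ), FeedbackChannel.IsAdmissible ch f G P π)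
    (s₀ : S) :
    ch.feedbackCapacity s₀ ≤
      ⨆ (P : S → Q → X → ℝ) (π : S × Q → ℝ) (_ : FeedbackChannel.IsAdmissible ch f G P π),
        ((FeedbackChannel.condMutualInfo (FeedbackChannel.jointLaw ch P π) : ℝ) : EReal) := by
  obtain ⟨P₀, π₀, h₀⟩ := hadm
  obtain ⟨c, hc⟩ := h₀.exists_reachable
  obtain ⟨q₀, hq₀⟩ := FeedbackChannel.exists_reachable_pair hf hconn G.next c s₀
  have : Nonempty X := by
    by_contra hX
    rw [not_nonempty_iff] at hX
    have h := (h₀.1 c.1 c.2).2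
    rw [Finset.univ_eq_empty, Finset.sum_empty] at h
    exact zero_ne_one h
  refine iSup₂_le fun R hR => ?_
  obtain ⟨J, hJ, hstat, hsupp, hbound⟩ := hR.exists_stationary (v₀ := (s₀, q₀)) hf hq₀
  have hlog : 0 < Real.log 2 := Real.log_pos one_lt_two
  -- The mixing weight is `1 / (n + 2)`, which is strictly below one even at `n = 0`.
  have key : ∀ n : ℕ, (((1 - 1 / ((n : ℝ) + 1 + 1)) * R : ℝ) : EReal) ≤
      ⨆ (P : S → Q → X → ℝ) (π : S × Q → ℝ) (_ : FeedbackChannel.IsAdmissible ch f G P π),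
        ((FeedbackChannel.condMutualInfo (FeedbackChannel.jointLaw ch P π) : ℝ) : EReal) := by
    intro n
    have hn : (0 : ℝ) < (n : ℝ) + 1 := by positivity
    have hε1 : 1 / ((n : ℝ) + 1 + 1) < 1 := by
      rw [div_lt_one (by positivity)]
      linarith
    obtain ⟨P, π, w, hPπ, hw0, hw1, hw, hle⟩ := FeedbackChannel.exists_admissible_approx hc hJ hstat
      hsupp (ε := 1 / ((n : ℝ) + 1 + 1)) (by positivity) hε1
    refine le_trans ?_ (le_iSup_of_le P (le_iSup_of_le π (le_iSup_of_le hPπ le_rfl)))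
    rw [EReal.coe_le_coe_iff]
    -- `J` was fixed before `w`, so the bound applies to the `w` that was built from `J`.
    have h1 := mul_le_mul_of_nonneg_left (hbound w hw0 hw1 hw) (sub_nonneg.2 hε1.le)
    refine le_of_mul_le_mul_left ?_ hlog
    linarith
  refine le_of_tendsto' (x := atTop) (f := fun n : ℕ => (((1 - 1 / ((n : ℝ) + 1 + 1)) * R : ℝ) : EReal)) ?_ key
  have h1 := (tendsto_one_div_add_atTop_nhds_zero_nat (𝕜 := ℝ)).comp (tendsto_add_atTop_nat 1)
  have h2 := (h1.const_sub 1).mul_const R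
  rw [sub_zero, one_mul] at h2
  refine (continuous_coe_real_ereal.tendsto R).comp (h2.congr fun n => ?_)
  simp
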